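/- Let $p\in[1,\infty]$, let $(\Omega,\mathfrak F,\mathbf P)$ be a complete non-atomic probability space, and let $r_1,\dots,r_d$ be finite-valued law invariant coherent risk measures on $L^p(\mathbb R)$: each $r_i$ is monotone ($\eta\le\eta'$ a.s. implies $r_i(\eta')\le r_i(\eta)$), cash invariant ($r_i(\eta+a)=r_i(\eta)-a$ for $a\in\mathbb R$), subadditive, positively homogeneous, and depends only on the distribution of its argument. If $p=\infty$, assume also that each $r_i$ has the Fatou property: $r_i(\eta)\le\liminf_n r_i(\eta_n)$ for uniformly essentially bounded $\eta_n\to\eta$ a.s. Inequalities between vectors are coordinatewise, and $\mathbf r(\xi)=(r_1(\xi_1),\dots,r_d(\xi_d))$. Let $C\in L^p(\mathbb R^d)$. For each $x\in\mathbb R^d$ let $\mathbf I(C+x)$ be a random closed set (closed valued, with $\{\mathbf I(C+x)\cap K\ne\emptyset\}\in\mathfrak F$ for all compact $K$) that is almost surely a lower set and satisfies $$\mathbb R_-^d\subset \mathbf I(C+x)\subset\Big\{y\in\mathbb R^d:\ \sum_{i=1}^d y_i\le 0\Big\}\quad\text{a.s.},$$ and put $\mathbf X(C+x)=C+x+\mathbf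 I(C+x)$. Call a random set $\mathbf Y$ acceptable if there is $\xi\in L^p(\mathbb R^d)$ with $\xi\in\mathbf Y$ a.s. and $\mathbf r(\xi)\le0$. Let $\mathsf R(\mathbf Y)$ be the closure of $\{a\in\mathbb R^d:\ \mathbf Y+a\text{ is acceptable}\}$. The group risk and the total risk are $$\mathcal R(\mathbf X(\cdot),C)=\{x\in\mathbb R^d:\ 0\in\mathsf R(\mathbf X(C+x))\},\qquad \rho_\Sigma(\mathbf X(\cdot),C)=\inf\Big\{\sum_{i=1}^d x_i:\ x\in\mathcal R(\mathbf X(\cdot),C)\Big\}.$$ Let $\partial^+\mathbf X(C+x)$ be the set of Pareto optimal points of $\mathbf X(C+x)$, that is, of its points that are not dominated coordinatewise by another of its points. Assume that 1. for every $x\in\mathbb R^d$, $\partial^+\mathbf X(C+x)$ is $p$-integrably bounded, i.e. $\sup\{\|y\|:\ y\in\partial^+\mathbf X(C+x)\}\in L^p(\mathbb R)$; 2. $x\mapsto\mathbf X(C+x)$ is upper semicontinuous in the $L^p$ sense: for every $x\in\mathbb R^d$ and every sequence $x_n\to x$ there are random variables $\zeta_n\ge0$ with $\|\zeta_n\|_p\to0$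 such that, for each $n$, $\mathbf X(C+x_n)\subset\mathbf X(C+x)+B_{\zeta_n}$ a.s., where $B_{\zeta_n}$ is the closed ball of radius $\zeta_n$ centred at the origin. Then $\mathcal R(\mathbf X(\cdot),C)$ is closed. If, in addition, there is $\xi\in L^p(\mathbb R^d)$ such that $\mathbf X(C+x)\subset\xi+x+\mathbb R_-^d$ a.s. for all $x\in\mathbb R^d$, then the infimum defining $\rho_\Sigma(\mathbf X(\cdot),C)$ is attained, i.e. there is $x\in\mathcal R(\mathbf X(\cdot),C)$ with $\sum_{i=1}^d x_i=\rho_\Sigma(\mathbf X(\cdot),C)$. -/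

import Mathlib

open MeasureTheory ProbabilityTheory Filter Topology
open scoped ENNReal Pointwise

namespace GroupRisk

/-- A measure is non-atomic if every measurable set of positive measure has a measurable subset
of strictly smaller positive measure. -/
def IsNonAtomic {Ω : Type*} [MeasurableSpace Ω] (P : Measure Ω) : Prop :=
  ∀ A : Set Ω, MeasurableSet A → 0 < P A →
    ∃ B : Set Ω, MeasurableSet B ∧ B ⊆ A ∧ 0 < P B ∧ P B < P A

/-! ### Risk measures

A finite risk measure on `L^p` is a function `(Ω → ℝ) → ℝ`, of which only the values at
`p`-integrable random variables matter; monotonicity makes these values depend only on the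
almost sure equivalence class. -/

/-- Finite monetary `L^p`-risk measures: monotone (decreasing) and cash invariant. -/
structure IsMonetaryRiskMeasure {Ω : Type*} [MeasurableSpace Ω] (P : Measure Ω) (p : ℝ≥0∞)
    (r : (Ω → ℝ) → ℝ) : Prop where
  antitone : ∀ η η' : Ω → ℝ, MemLp η p P → MemLp η' p P → η ≤ᵐ[P] η' → r η' ≤ r η
  cash_invariant : ∀ (η : Ω → ℝ) (a : ℝ), MemLp η p P → r (fun ω => η ω + a) = r η - a

/-- Coherent `L^p`-risk measures: monetary, subadditive and positively homogeneous. -/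
structure IsCoherentRiskMeasure {Ω : Type*} [MeasurableSpace Ω] (P : Measure Ω) (p : ℝ≥0∞)
    (r : (Ω → ℝ) → ℝ) : Prop extends IsMonetaryRiskMeasure P p r where
  subadditive : ∀ η η' : Ω → ℝ, MemLp η p P → MemLp η' p P →
    r (fun ω => η ω + η' ω) ≤ r η + r η'
  homogeneous : ∀ (η : Ω → ℝ) (t : ℝ), MemLp η p P → 0 < t → r (fun ω => t * η ω) = t * r η

/-- Law invariance on `L^p`. -/
def IsLawInvariant {Ω : Type*} [MeasurableSpace Ω] (P : Measure Ω) (p : ℝ≥0∞)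
    (r : (Ω → ℝ) → ℝ) : Prop :=
  ∀ η η' : Ω → ℝ, MemLp η p P → MemLp η' p P → IdentDistrib η η' P P → r η = r η'

/-- The Fatou property on `L^∞`: lower semicontinuity along uniformly bounded almost surely
convergent sequences. -/
def HasFatouProperty {Ω : Type*} [MeasurableSpace Ω] (P : Measure Ω)
    (r : (Ω → ℝ) → ℝ) : Prop :=
  ∀ (η : ℕ → Ω → ℝ) (η' : Ω → ℝ), (∀ n, MemLp (η n) ∞ P) → MemLp η' ∞ P →
    (∃ M : ℝ, ∀ n, ∀ᵐ ω ∂P, |η n ω| ≤ M) →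
    (∀ᵐ ω ∂P, Tendsto (fun n => η n ω) atTop (𝓝 (η' ω))) →
    (r η' : EReal) ≤ liminf (fun n => (r (η n) : EReal)) atTop

/-! ### Random closed sets and admissible transfers -/

/-- Random closed sets in `ℝ^d`: closed values, and all compact sets are hit on measurable
events. -/
structure IsRandomClosedSet {Ω : Type*} [MeasurableSpace Ω] {d : ℕ}
    (X : Ω → Set (EuclideanSpace ℝ (Fin d))) : Prop where
  isClosed : ∀ ω, IsClosed (X ω)
  measurableSet_hit : ∀ K : Set (EuclideanSpace ℝ (Fin d)), IsCompact K →
    MeasurableSet {ω | (X ω ∩ K).Nonempty}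

/-- Lower sets of `ℝ^d` for the coordinatewise order. -/
def IsLower {d : ℕ} (A : Set (EuclideanSpace ℝ (Fin d))) : Prop :=
  ∀ x ∈ A, ∀ y : EuclideanSpace ℝ (Fin d), (∀ i, y i ≤ x i) → y ∈ A

/-- The orthant `ℝ_-^d`. -/
def negOrthant (d : ℕ) : Set (EuclideanSpace ℝ (Fin d)) := {x | ∀ i, x i ≤ 0}

/-- The half-space `{x : ∑ x_i ≤ 0}`. -/
def halfSpace (d : ℕ) : Set (EuclideanSpace ℝ (Fin d)) := {x | ∑ i, x i ≤ 0}

/-- Random sets of admissible intragroup transfers: random closed sets `J`, almost surely lower,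
with `ℝ_-^d ⊆ J ⊆ {x : ∑ x_i ≤ 0}` almost surely. -/
structure IsTransferSet {Ω : Type*} [MeasurableSpace Ω] (P : Measure Ω) {d : ℕ}
    (J : Ω → Set (EuclideanSpace ℝ (Fin d))) : Prop extends IsRandomClosedSet J where
  isLower : ∀ᵐ ω ∂P, IsLower (J ω)
  orthant_subset : ∀ᵐ ω ∂P, negOrthant d ⊆ J ω
  subset_halfSpace : ∀ᵐ ω ∂P, J ω ⊆ halfSpace d

/-- The set `X(C) = C + I(C)` of attainable positions. Here `I` assigns to each random vector of
terminal positions a random set of transfers, so that `I(C)(ω)` may depend on `C` and on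
additional randomness. -/
def attainable {Ω : Type*} {d : ℕ}
    (I : (Ω → EuclideanSpace ℝ (Fin d)) → Ω → Set (EuclideanSpace ℝ (Fin d)))
    (C : Ω → EuclideanSpace ℝ (Fin d)) : Ω → Set (EuclideanSpace ℝ (Fin d)) :=
  fun ω => {C ω} + I C ω

/-- The Pareto optimal points of `A`: those not dominated coordinatewise by another point
of `A`. -/
def pareto {d : ℕ} (A : Set (EuclideanSpace ℝ (Fin d))) : Set (EuclideanSpace ℝ (Fin d)) :=
  {x | x ∈ A ∧ ∀ y ∈ A, (∀ i, x i ≤ y i) → y = x}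

/-- A random set `Y` is `p`-integrably bounded if `‖Y‖ = sup {‖x‖ : x ∈ Y}`, with values in
`[0, ∞]`, belongs to `L^p`. -/
def IntegrablyBounded {Ω : Type*} [MeasurableSpace Ω] (P : Measure Ω) (p : ℝ≥0∞) {d : ℕ}
    (Y : Ω → Set (EuclideanSpace ℝ (Fin d))) : Prop :=
  MemLp (fun ω => ⨆ x ∈ Y ω, ‖x‖ₑ) p P

/-- Upper semicontinuity in the `L^p` sense of a family `F(x)` of random sets: if `x_n → x`, then
`F(x_n) ⊆ F(x) + B_{ζ_n}` almost surely, for random radii `ζ_n` with `‖ζ_n‖_p → 0`. -/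
def UpperSemicontinuousLp {Ω : Type*} [MeasurableSpace Ω] (P : Measure Ω) (p : ℝ≥0∞) {d : ℕ}
    (F : EuclideanSpace ℝ (Fin d) → Ω → Set (EuclideanSpace ℝ (Fin d))) : Prop :=
  ∀ (x : EuclideanSpace ℝ (Fin d)) (u : ℕ → EuclideanSpace ℝ (Fin d)),
    Tendsto u atTop (𝓝 x) →
    ∃ ζ : ℕ → Ω → ℝ, (∀ n, AEStronglyMeasurable (ζ n) P) ∧ (∀ n, 0 ≤ᵐ[P] ζ n) ∧
      Tendsto (fun n => eLpNorm (ζ n) p P) atTop (𝓝 0) ∧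
      ∀ n, ∀ᵐ ω ∂P, F (u n) ω ⊆ F x ω + Metric.closedBall 0 (ζ n ω)

/-! ### Acceptability, selection risk measure, group risk, total risk -/

/-- `X` is acceptable if it has a `p`-integrable selection all of whose marginals are
acceptable. -/
def IsAcceptable {Ω : Type*} [MeasurableSpace Ω] (P : Measure Ω) (p : ℝ≥0∞) {d : ℕ}
    (r : Fin d → (Ω → ℝ) → ℝ) (X : Ω → Set (EuclideanSpace ℝ (Fin d))) : Prop :=
  ∃ ξ : Ω → EuclideanSpace ℝ (Fin d), MemLp ξ p P ∧ (∀ᵐ ω ∂P, ξ ω ∈ X ω) ∧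
    ∀ i, r i (fun ω => ξ ω i) ≤ 0

/-- The selection risk measure: the closure of the set of all `a` for which `X + a` is
acceptable. -/
def selectionRisk {Ω : Type*} [MeasurableSpace Ω] (P : Measure Ω) (p : ℝ≥0∞) {d : ℕ}
    (r : Fin d → (Ω → ℝ) → ℝ) (X : Ω → Set (EuclideanSpace ℝ (Fin d))) :
    Set (EuclideanSpace ℝ (Fin d)) :=
  closure {a | IsAcceptable P p r (fun ω => X ω + {a})}

/-- The group risk: all `x` such that the selection risk measure of `X(C + x)` contains the
origin. -/
def groupRisk {Ω : Type*} [MeasurableSpace Ω] (P : Measure Ω) (p : ℝ≥0∞) {d : ℕ}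
    (r : Fin d → (Ω → ℝ) → ℝ)
    (X : (Ω → EuclideanSpace ℝ (Fin d)) → Ω → Set (EuclideanSpace ℝ (Fin d)))
    (C : Ω → EuclideanSpace ℝ (Fin d)) : Set (EuclideanSpace ℝ (Fin d)) :=
  {x | 0 ∈ selectionRisk P p r (X (fun ω => C ω + x))}

/-- The total risk: the infimum, in `[-∞, ∞]`, of `∑ x_i` over the group risk. -/
noncomputable def totalRisk {Ω : Type*} [MeasurableSpace Ω] (P : Measure Ω) (p : ℝ≥0∞) {d : ℕ}
    (r : Fin d → (Ω → ℝ) → ℝ)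
    (X : (Ω → EuclideanSpace ℝ (Fin d)) → Ω → Set (EuclideanSpace ℝ (Fin d)))
    (C : Ω → EuclideanSpace ℝ (Fin d)) : EReal :=
  ⨅ x ∈ groupRisk P p r X C, ((∑ i, x i : ℝ) : EReal)

end GroupRisk

/-!
Both assertions rest on the fact that a finite coherent risk measure `r` on `L^p` is automatically
bounded on nonpositive variables: `r (-ζ) ≤ K ‖ζ‖_p` for `ζ ≥ 0`
(`IsCoherentRiskMeasure.exists_bound`). Otherwise there are `ζ_n ≥ 0` with `‖ζ_n‖_p = 2⁻ⁿ` and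
`r (-ζ_n) > 2ⁿ`; by monotonicity the finite number `r (-∑ ζ_n)` would exceed every `2ⁿ`.

For closedness, let `x_n → x` with `x_n` in the group risk. A selection `φ` of `X(C + x_n) + a`
satisfies `φ - ζ_n (1, …, 1) ∈ X(C + x) + a`, because `X(C + x_n) ⊆ X(C + x) + B_{ζ_n}` and
`X(C + x)` is a lower set; so a selection of `X(C + x)` is written down explicitly, and no
measurable selection theorem is needed. By subadditivity and the bound above, its risk exceeds that
of `φ` by at most `K ‖ζ_n‖_p`, which a vanishing translation compensates
(`IsAcceptable.of_subset_add_closedBall`). Since the selection risk is a closure, `0` belongs to it.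

For attainment, the domination `X(C + x) ⊆ ξ + x + ℝ_-^d` forces `r_i(ξ_i) ≤ x_i` on the group
risk, so that its points of bounded coordinate sum form a compact set. This set is nonempty since
`C + x` is a selection of `X(C + x)`, acceptable for `x = r(C)`.
-/

namespace GroupRisk

variable {Ω : Type*} [MeasurableSpace Ω] {P : Measure Ω} {p : ℝ≥0∞} {d : ℕ}

/-! ### Boundedness of coherent risk measures -/

section Bound

variable {r : (Ω → ℝ) → ℝ}

lemma IsCoherentRiskMeasure.map_zero (hr : IsCoherentRiskMeasure P p r) :
    r (fun _ => 0) = 0 := by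
  have h := hr.homogeneous (fun _ => 0) 2 MemLp.zero two_pos
  simp only [mul_zero] at h
  linarith

/-- Along a sequence of nonnegative variables with summable norms, the risks `r (-ζ n)` are bounded
above: by monotonicity, the risk of minus the sum of the series is a bound. -/
lemma IsMonetaryRiskMeasure.bddAbove_of_summable (hr : IsMonetaryRiskMeasure P p r) (hp : 1 ≤ p)
    {ζ : ℕ → Ω → ℝ} (hζ : ∀ n, MemLp (ζ n) p P) (hpos : ∀ n, 0 ≤ᵐ[P] ζ n)
    (hsum : Summable fun n => (eLpNorm (ζ n) p P).toReal) :
    BddAbove (Set.range fun n => r (fun ω => -ζ n ω)) := by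
  have : Fact (1 ≤ p) := ⟨hp⟩
  let z : ℕ → Lp ℝ p P := fun n => (hζ n).toLp (ζ n)
  have hz : Summable z := by
    refine Summable.of_norm ?_
    simpa only [z, Lp.norm_toLp] using hsum
  have hz0 : ∀ n, 0 ≤ z n := fun n => by
    rw [← Lp.coeFn_nonneg]
    filter_upwards [(hζ n).coeFn_toLp, hpos n] with ω h1 h2
    rw [h1]
    exact h2
  have hS : MemLp (fun ω => -(∑' n, z n : Lp ℝ p P) ω) p P := (Lp.memLp _).neg
  refine ⟨r (fun ω => -(∑' n, z n : Lp ℝ p P) ω), ?_⟩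
  rintro _ ⟨n, rfl⟩
  refine hr.antitone _ _ hS (hζ n).neg ?_
  have hle : z n ≤ ∑' n, z n := hz.le_tsum n fun m _ => hz0 m
  rw [← Lp.coeFn_le] at hle
  filter_upwards [hle, (hζ n).coeFn_toLp] with ω h1 h2
  rw [h2] at h1
  exact neg_le_neg h1

/-- A finite coherent risk measure on `L^p` is bounded on nonpositive variables. -/
lemma IsCoherentRiskMeasure.exists_bound (hr : IsCoherentRiskMeasure P p r) (hp : 1 ≤ p) :
    ∃ K : ℝ, ∀ ζ : Ω → ℝ, MemLp ζ p P → 0 ≤ᵐ[P] ζ →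
      r (fun ω => -ζ ω) ≤ K * (eLpNorm ζ p P).toReal := by
  by_contra! hcon
  choose ζ hζ hpos hlt using fun n : ℕ => hcon (4 ^ n)
  have hnorm : ∀ n, 0 < (eLpNorm (ζ n) p P).toReal := by
    intro n
    refine lt_of_le_of_ne ENNReal.toReal_nonneg fun h0 => ?_
    have h1 : eLpNorm (ζ n) p P = 0 :=
      ((ENNReal.toReal_eq_zero_iff _).1 h0.symm).resolve_right (hζ n).2.ne
    have h2 : ζ n =ᵐ[P] 0 :=
      (eLpNorm_eq_zero_iff (hζ n).1 (one_pos.trans_le hp).ne').1 h1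
    have h3 : r (fun ω => -ζ n ω) ≤ r (fun _ => 0) := by
      refine hr.antitone _ _ MemLp.zero (hζ n).neg ?_
      filter_upwards [h2] with ω hω
      simp [hω]
    have h4 := hlt n
    rw [← h0, mul_zero] at h4
    rw [hr.map_zero] at h3
    exact h3.not_gt h4
  -- After rescaling to norm `2⁻ⁿ`, the risks exceed `4ⁿ * 2⁻ⁿ = 2ⁿ`.
  let t : ℕ → ℝ := fun n => (1 / 2) ^ n / (eLpNorm (ζ n) p P).toReal
  have ht : ∀ n, 0 < t n := fun n => div_pos (by positivity) (hnorm n)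
  obtain ⟨B, hB⟩ := hr.bddAbove_of_summable hp (ζ := fun n ω => t n * ζ n ω)
    (fun n => (hζ n).const_mul (t n))
    (fun n => by
      filter_upwards [hpos n] with ω hω
      exact mul_nonneg (ht n).le hω)
    (by
      have h : ∀ n, (eLpNorm (fun ω => t n * ζ n ω) p P).toReal = (1 / 2) ^ n := fun n => by
        have h1 := eLpNorm_const_smul (t n) (ζ n) p P
        have h2 : t n • ζ n = fun ω => t n * ζ n ω := rfl
        rw [h2] at h1
        rw [h1, ENNReal.toReal_mul, toReal_enorm, Real.norm_of_nonneg (ht n).le]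
        exact div_mul_cancel₀ _ (hnorm n).ne'
      simpa only [h] using summable_geometric_two)
  obtain ⟨n, hn⟩ := pow_unbounded_of_one_lt B one_lt_two
  have h1 : r (fun ω => -(t n * ζ n ω)) ≤ B := hB ⟨n, rfl⟩
  have h2 := hr.homogeneous _ (t n) (hζ n).neg (ht n)
  simp only [Pi.neg_apply, mul_neg] at h2
  have h3 : (2 : ℝ) ^ n < t n * r (fun ω => -ζ n ω) := by
    calc (2 : ℝ) ^ n = t n * (4 ^ n * (eLpNorm (ζ n) p P).toReal) := by
          have := (hnorm n).ne'
          simp only [t]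
          field_simp
          rw [← mul_pow]
          norm_num
      _ < _ := mul_lt_mul_of_pos_left (hlt n) (ht n)
  change r (fun ω => -(t n * ζ n ω)) = t n * r (fun ω => -ζ n ω) at h2
  linarith

end Bound

/-! ### Closedness of the group risk -/

lemma memLp_coord {ξ : Ω → EuclideanSpace ℝ (Fin d)} (hξ : MemLp ξ p P) (i : Fin d) :
    MemLp (fun ω => ξ ω i) p P :=
  (EuclideanSpace.proj i : EuclideanSpace ℝ (Fin d) →L[ℝ] ℝ).comp_memLp' hξ

lemma IsLower.singleton_add {A : Set (EuclideanSpace ℝ (Fin d))} (hA : IsLower A)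
    (c : EuclideanSpace ℝ (Fin d)) : IsLower ({c} + A) := by
  rintro _ ⟨c', rfl, a, ha, rfl⟩ y hy
  refine ⟨c', rfl, y - c', hA a ha _ fun i => ?_, add_sub_cancel _ _⟩
  have := hy i
  simp only [PiLp.add_apply] at this
  simp only [PiLp.sub_apply]
  linarith

/-- Within a lower set `A`, a point of `A + B_s` is corrected to a point of `A` by lowering each of
its coordinates by `s`. -/
lemma IsLower.sub_smul_mem {A : Set (EuclideanSpace ℝ (Fin d))} (hA : IsLower A) {s : ℝ}
    {y : EuclideanSpace ℝ (Fin d)} (hy : y ∈ A + Metric.closedBall 0 s) :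
    y - s • WithLp.toLp 2 (fun _ => (1 : ℝ)) ∈ A := by
  obtain ⟨a, ha, b, hb, rfl⟩ := hy
  refine hA a ha _ fun i => ?_
  have h1 : b i ≤ s := calc
    b i ≤ ‖b i‖ := Real.le_norm_self _
    _ ≤ ‖b‖ := PiLp.norm_apply_le b i
    _ ≤ s := mem_closedBall_zero_iff.1 hb
  simp only [PiLp.sub_apply, PiLp.add_apply, PiLp.smul_apply, smul_eq_mul, mul_one]
  linarith

/-- Acceptability passes from `X + a` to `Y + a + b` if `Y` is a random lower set with
`X ⊆ Y + B_ζ` and the deterministic vector `b` covers the risks of `-ζ`. -/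
lemma IsAcceptable.of_subset_add_closedBall {r : Fin d → (Ω → ℝ) → ℝ}
    (hr : ∀ i, IsCoherentRiskMeasure P p (r i)) [IsFiniteMeasure P]
    {X Y : Ω → Set (EuclideanSpace ℝ (Fin d))} (hY : ∀ᵐ ω ∂P, IsLower (Y ω))
    {ζ : Ω → ℝ} (hζ : MemLp ζ p P)
    (hXY : ∀ᵐ ω ∂P, X ω ⊆ Y ω + Metric.closedBall 0 (ζ ω)) {a b : EuclideanSpace ℝ (Fin d)}
    (hb : ∀ i, r i (fun ω => -ζ ω) ≤ b i) (hX : IsAcceptable P p r (fun ω => X ω + {a})) :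
    IsAcceptable P p r (fun ω => Y ω + {a + b}) := by
  obtain ⟨φ, hφ, hmem, hle⟩ := hX
  have hζ1 : MemLp (fun ω => ζ ω • (WithLp.toLp 2 (fun _ => (1 : ℝ)) :
      EuclideanSpace ℝ (Fin d))) p P :=
    ((ContinuousLinearMap.id ℝ ℝ).smulRight
      (WithLp.toLp 2 (fun _ => (1 : ℝ)) : EuclideanSpace ℝ (Fin d))).comp_memLp' hζ
  refine ⟨fun ω => φ ω - ζ ω • WithLp.toLp 2 (fun _ => (1 : ℝ)) + b,
    (hφ.sub hζ1).add (memLp_const b), ?_, fun i => ?_⟩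
  · filter_upwards [hY, hXY, hmem] with ω h1 h2 h3
    obtain ⟨y, hy, a', rfl, h⟩ := h3
    refine ⟨_, h1.sub_smul_mem (h2 hy), _, rfl, ?_⟩
    rw [← h]
    simp only
    abel
  · have h1 := (hr i).cash_invariant (fun ω => φ ω i + -ζ ω) (b i)
      ((memLp_coord hφ i).add hζ.neg)
    have h2 := (hr i).subadditive (fun ω => φ ω i) (fun ω => -ζ ω) (memLp_coord hφ i) hζ.neg
    have h3 : (fun ω => (φ ω - ζ ω • (WithLp.toLp 2 (fun _ => (1 : ℝ)) :
        EuclideanSpace ℝ (Fin d)) + b) i) = fun ω => φ ω i + -ζ ω + b i := by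
      ext ω
      simp [sub_eq_add_neg]
    rw [h3, h1]
    linarith [hle i, hb i]

/-- The points `x` whose random set `F x` has the origin in its selection risk form a closed set,
for every family `F` of random lower sets that is upper semicontinuous in the `L^p` sense. -/
lemma isClosed_setOf_zero_mem_selectionRisk {r : Fin d → (Ω → ℝ) → ℝ}
    (hr : ∀ i, IsCoherentRiskMeasure P p (r i)) [IsFiniteMeasure P] (hp : 1 ≤ p)
    {F : EuclideanSpace ℝ (Fin d) → Ω → Set (EuclideanSpace ℝ (Fin d))}
    (hF : ∀ x, ∀ᵐ ω ∂P, IsLower (F x ω)) (husc : UpperSemicontinuousLp P p F) :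
    IsClosed {x | 0 ∈ selectionRisk P p r (F x)} := by
  refine IsSeqClosed.isClosed fun u x hu hux => ?_
  obtain ⟨ζ, hζm, hζ0, hζ, hsub⟩ := husc x u hux
  choose K hK using fun i => (hr i).exists_bound hp
  let b : ℕ → EuclideanSpace ℝ (Fin d) :=
    fun n => (eLpNorm (ζ n) p P).toReal • WithLp.toLp 2 K
  have hb : Tendsto b atTop (𝓝 0) := by
    have h := ((ENNReal.tendsto_toReal ENNReal.zero_ne_top).comp hζ).smul_const
      (WithLp.toLp 2 K : EuclideanSpace ℝ (Fin d))
    simpa using h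
  refine Metric.mem_closure_iff.2 fun ε hε => ?_
  -- The norms of the radii are only finite eventually.
  obtain ⟨n, hn1, hn2⟩ := ((hζ.eventually_lt_const ENNReal.zero_lt_top).and
    (hb.eventually (Metric.ball_mem_nhds 0 (half_pos hε)))).exists
  obtain ⟨a, ha, hda⟩ := Metric.mem_closure_iff.1 (hu n) (ε / 2) (half_pos hε)
  have hmem : MemLp (ζ n) p P := ⟨hζm n, hn1⟩
  refine ⟨a + b n, IsAcceptable.of_subset_add_closedBall hr (hF x) hmem (hsub n) (fun i => ?_) ha,
    ?_⟩
  · have := hK i (ζ n) hmem (hζ0 n)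
    simpa [b, mul_comm] using this
  · rw [dist_zero_left] at hda ⊢
    rw [dist_zero_right] at hn2
    linarith [norm_add_le a (b n)]

/-! ### Attainment of the total risk -/

/-- Acceptable translates of a random set dominated by `ξ` are bounded below by the risks
of `ξ`. -/
lemma IsAcceptable.risk_le {r : Fin d → (Ω → ℝ) → ℝ}
    (hr : ∀ i, IsMonetaryRiskMeasure P p (r i)) [IsFiniteMeasure P]
    {X : Ω → Set (EuclideanSpace ℝ (Fin d))} {ξ : Ω → EuclideanSpace ℝ (Fin d)}
    (hξ : MemLp ξ p P) {x a : EuclideanSpace ℝ (Fin d)}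
    (hX : ∀ᵐ ω ∂P, X ω ⊆ {ξ ω + x} + negOrthant d)
    (ha : IsAcceptable P p r (fun ω => X ω + {a})) (i : Fin d) :
    r i (fun ω => ξ ω i) ≤ x i + a i := by
  obtain ⟨φ, hφ, hmem, hle⟩ := ha
  have hξi := memLp_coord hξ i
  have h1 : r i (fun ω => ξ ω i + (x i + a i)) ≤ r i (fun ω => φ ω i) := by
    refine (hr i).antitone _ _ (memLp_coord hφ i) (hξi.add (memLp_const _)) ?_
    filter_upwards [hX, hmem] with ω h2 h3
    obtain ⟨y, hy, a', rfl, h⟩ := h3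
    obtain ⟨y', rfl, z, hz, rfl⟩ := h2 hy
    have hzi : z i ≤ 0 := hz i
    rw [← h]
    simp only [PiLp.add_apply]
    linarith
  rw [(hr i).cash_invariant _ _ hξi] at h1
  linarith [hle i]

/-- The lower bound of `IsAcceptable.risk_le` at `a = 0` persists under the closure in the
definition of the selection risk. -/
lemma risk_le_of_zero_mem_selectionRisk {r : Fin d → (Ω → ℝ) → ℝ}
    (hr : ∀ i, IsMonetaryRiskMeasure P p (r i)) [IsFiniteMeasure P]
    {X : Ω → Set (EuclideanSpace ℝ (Fin d))} {ξ : Ω → EuclideanSpace ℝ (Fin d)}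
    (hξ : MemLp ξ p P) {x : EuclideanSpace ℝ (Fin d)}
    (hX : ∀ᵐ ω ∂P, X ω ⊆ {ξ ω + x} + negOrthant d) (h0 : 0 ∈ selectionRisk P p r X) (i : Fin d) :
    r i (fun ω => ξ ω i) ≤ x i := by
  have hcl : IsClosed {a : EuclideanSpace ℝ (Fin d) | r i (fun ω => ξ ω i) ≤ x i + a i} :=
    isClosed_le continuous_const (by fun_prop)
  have h : (0 : EuclideanSpace ℝ (Fin d)) ∈ {a : EuclideanSpace ℝ (Fin d) |
      r i (fun ω => ξ ω i) ≤ x i + a i} :=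
    closure_minimal (fun a ha => IsAcceptable.risk_le hr hξ hX ha i) hcl h0
  simpa using h

/-- Without any transfer, the capital vector `r(C)` makes all positions acceptable. -/
lemma risk_mem_groupRisk {r : Fin d → (Ω → ℝ) → ℝ}
    (hr : ∀ i, IsMonetaryRiskMeasure P p (r i)) [IsFiniteMeasure P]
    {C : Ω → EuclideanSpace ℝ (Fin d)} (hC : MemLp C p P)
    {I : (Ω → EuclideanSpace ℝ (Fin d)) → Ω → Set (EuclideanSpace ℝ (Fin d))}
    (hI : ∀ x : EuclideanSpace ℝ (Fin d), ∀ᵐ ω ∂P, negOrthant d ⊆ I (fun ω => C ω + x) ω) :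
    WithLp.toLp 2 (fun i => r i (fun ω => C ω i)) ∈ groupRisk P p r (attainable I) C := by
  set x : EuclideanSpace ℝ (Fin d) := WithLp.toLp 2 (fun i => r i (fun ω => C ω i)) with hx
  refine subset_closure ⟨fun ω => C ω + x, hC.add (memLp_const x), ?_, fun i => ?_⟩
  · filter_upwards [hI x] with ω hω
    exact ⟨C ω + x, ⟨C ω + x, rfl, 0, hω fun _ => le_rfl, add_zero _⟩, 0, rfl, add_zero _⟩
  · have h := (hr i).cash_invariant (fun ω => C ω i) (x i) (memLp_coord hC i)
    simp only [PiLp.add_apply]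
    rw [h, hx]
    exact (sub_self _).le

/-- On a nonempty closed subset of `ℝ^d` that is coordinatewise bounded below, the coordinate sum
attains its minimum: sublevel sets are bounded, since all other coordinates being bounded below
turns an upper bound on the sum into an upper bound on each coordinate. -/
lemma exists_sum_le_of_isClosed {G : Set (EuclideanSpace ℝ (Fin d))} (hG : IsClosed G)
    (hne : G.Nonempty) {m : Fin d → ℝ} (hm : ∀ x ∈ G, ∀ i, m i ≤ x i) :
    ∃ x ∈ G, ∀ y ∈ G, ∑ i, x i ≤ ∑ i, y i := by
  obtain ⟨x₀, hx₀⟩ := hne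
  set T : Set (EuclideanSpace ℝ (Fin d)) := G ∩ {x | ∑ i, x i ≤ ∑ i, x₀ i} with hT
  have hcont : Continuous fun x : EuclideanSpace ℝ (Fin d) => ∑ i, x i := by fun_prop
  have hTcl : IsClosed T := hG.inter (isClosed_le hcont continuous_const)
  have hTb : T ⊆ (EuclideanSpace.equiv (Fin d) ℝ).symm ''
      Set.Icc m (fun i => m i + (∑ j, x₀ j - ∑ j, m j)) := by
    rintro x ⟨hxG, hxs⟩
    refine ⟨EuclideanSpace.equiv (Fin d) ℝ x, ⟨hm x hxG, fun i => ?_⟩, by simp⟩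
    have h1 : x i - m i ≤ ∑ j, (x j - m j) :=
      Finset.single_le_sum (f := fun j => x j - m j)
        (fun j _ => sub_nonneg.2 (hm x hxG j)) (Finset.mem_univ i)
    rw [Finset.sum_sub_distrib] at h1
    have hxs' : ∑ i, x i ≤ ∑ i, x₀ i := hxs
    change x i ≤ _
    linarith
  have hTc : IsCompact T :=
    (isCompact_Icc.image (EuclideanSpace.equiv (Fin d) ℝ).symm.continuous).of_isClosed_subset
      hTcl hTb
  obtain ⟨x, hxT, hmin⟩ := hTc.exists_isMinOn ⟨x₀, hx₀, le_refl (∑ i, x₀ i)⟩ hcont.continuousOn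
  refine ⟨x, hxT.1, fun y hy => ?_⟩
  by_cases h : ∑ i, y i ≤ ∑ i, x₀ i
  · exact hmin ⟨hy, h⟩
  · exact le_trans hxT.2 (not_le.1 h).le

end GroupRisk

theorem mainTheorem3 {Ω : Type*} [MeasurableSpace Ω] (P : Measure Ω) [IsProbabilityMeasure P]
    [P.IsComplete] (hP : GroupRisk.IsNonAtomic P) (p : ℝ≥0∞) (hp : 1 ≤ p) (d : ℕ)
    (r : Fin d → (Ω → ℝ) → ℝ)
    (hr : ∀ i, GroupRisk.IsCoherentRiskMeasure P p (r i))
    (hlaw : ∀ i, GroupRisk.IsLawInvariant P p (r i))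
    (hfatou : p = ∞ → ∀ i, GroupRisk.HasFatouProperty P (r i))
    (C : Ω → EuclideanSpace ℝ (Fin d)) (hC : MemLp C p P)
    (I : (Ω → EuclideanSpace ℝ (Fin d)) → Ω → Set (EuclideanSpace ℝ (Fin d)))
    (hI : ∀ x : EuclideanSpace ℝ (Fin d), GroupRisk.IsTransferSet P (I (fun ω => C ω + x)))
    (hbdd : ∀ x : EuclideanSpace ℝ (Fin d), GroupRisk.IntegrablyBounded P p
      (fun ω => GroupRisk.pareto (GroupRisk.attainable I (fun ω' => C ω' + x) ω)))
    (husc : GroupRisk.UpperSemicontinuousLp P p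
      (fun x => GroupRisk.attainable I (fun ω => C ω + x))) :
    IsClosed (GroupRisk.groupRisk P p r (GroupRisk.attainable I) C) ∧
    ((∃ ξ : Ω → EuclideanSpace ℝ (Fin d), MemLp ξ p P ∧
        ∀ x : EuclideanSpace ℝ (Fin d), ∀ᵐ ω ∂P,
          GroupRisk.attainable I (fun ω' => C ω' + x) ω ⊆ {ξ ω + x} + GroupRisk.negOrthant d) →
      ∃ x ∈ GroupRisk.groupRisk P p r (GroupRisk.attainable I) C,
        ((∑ i, x i : ℝ) : EReal) = GroupRisk.totalRisk P p r (GroupRisk.attainable I) C) := by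
  have hclosed : IsClosed (GroupRisk.groupRisk P p r (GroupRisk.attainable I) C) := by
    refine GroupRisk.isClosed_setOf_zero_mem_selectionRisk hr hp (fun x => ?_) husc
    filter_upwards [(hI x).isLower] with ω hω
    exact hω.singleton_add _
  refine ⟨hclosed, ?_⟩
  rintro ⟨ξ, hξ, hdom⟩
  have hmon := fun i => (hr i).toIsMonetaryRiskMeasure
  obtain ⟨x, hx, hmin⟩ := GroupRisk.exists_sum_le_of_isClosed hclosed
    ⟨_, GroupRisk.risk_mem_groupRisk hmon hC fun x => (hI x).orthant_subset⟩
    fun x hx i => GroupRisk.risk_le_of_zero_mem_selectionRisk hmon hξ (hdom x) hx i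
  refine ⟨x, hx, le_antisymm ?_ ?_⟩
  · exact le_iInf₂ fun y hy => EReal.coe_le_coe_iff.2 (hmin y hy)
  · exact iInf₂_le x hx
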